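/- Let $P(x_1,x_2) = (x_1^2+x_2^2)^2 + 18(x_1^2+x_2^2) - 8x_1^3 + 24x_1x_2^2 - 27$, so that $\{P=0\}\subset\mathbb{R}^2$ is the deltoid curve $\theta\mapsto(2\cos\theta+\cos 2\theta,\ 2\sin\theta-\sin 2\theta)$, and let $\Omega$ be the interior of this curve, i.e. the set of points of $\mathbb{R}^2\setminus\{P=0\}$ whose connected component in $\mathbb{R}^2\setminus\{P=0\}$ is bounded. Let $g=(g_{ij})$ be the symmetric $2\times 2$ matrix with entries $$g_{11} = -(3x_1^2-x_2^2-6x_1-9),\qquad g_{12}=g_{21} = -2x_2(2x_1+3),\qquad g_{22} = -(3x_2^2-x_1^2+6x_1-9).$$ Then $\det(g) = -3P$ on $\mathbb{R}^2$ and $\det(g)>0$ on $\Omega$, and for every real number $\alpha$ the function $\det(g)^\alpha$ is integrable on $\Omega$ with respect to the Lebesgue measure if and only if $\alpha > -\tfrac56$. -/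

import Mathlib

/-- The quartic polynomial whose zero set in the plane is the deltoid curve. -/
def deltoidP (x : ℝ × ℝ) : ℝ :=
  (x.1 ^ 2 + x.2 ^ 2) ^ 2 + 18 * (x.1 ^ 2 + x.2 ^ 2) - 8 * x.1 ^ 3 + 24 * x.1 * x.2 ^ 2 - 27

/-- The deltoid curve, with parametrization
`(2 cos θ + cos 2θ, 2 sin θ - sin 2θ)` and equation `deltoidP x = 0`. -/
def deltoidCurve : Set (ℝ × ℝ) := {x | deltoidP x = 0}

/-- The interior of the deltoid curve: the points off the curve that lie in a bounded
connected component of the complement of the curve. -/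
def deltoidInterior : Set (ℝ × ℝ) :=
  {x | x ∉ deltoidCurve ∧ Bornology.IsBounded (connectedComponentIn deltoidCurveᶜ x)}

/-- The symmetric matrix `g = (g_ij)` of second order coefficients of the diffusion operators
attached to the deltoid. -/
def deltoidG (x : ℝ × ℝ) : Matrix (Fin 2) (Fin 2) ℝ :=
  !![-(3 * x.1 ^ 2 - x.2 ^ 2 - 6 * x.1 - 9), -2 * x.2 * (2 * x.1 + 3);
     -2 * x.2 * (2 * x.1 + 3), -(3 * x.2 ^ 2 - x.1 ^ 2 + 6 * x.1 - 9)]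

open MeasureTheory Set

/-! The interior is `deltoidP < 0` (`deltoidInterior_eq`), where the determinant lies in `(0, 81]`.
Integrability therefore passes to larger exponents, and it suffices to treat `-5/6` itself and `-5/6
< α ≤ 0`.

The cusps decide. Near `(3, 0)`, put `u = 3 - x`: the vertical slice has half-width `w ~ u ^ (3/2)`,
and `-deltoidP` behaves like `w ^ 2 - y ^ 2`. The slice integral is then of order `w ^ (2α + 1) ~ u
^ (3α + 3/2)`, integrable at `u = 0` exactly when `α > -5/6`. The half-plane `0 ≤ x` contains only
this cusp, and rotations by `2π/3`, which preserve `deltoidP`, reduce the whole domain to it. -/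

theorem deltoidG_det (x : ℝ × ℝ) : (deltoidG x).det = -3 * deltoidP x := by
  simp only [deltoidG, Matrix.det_fin_two_of, deltoidP]
  ring

/-! ### The interior as a sublevel set -/

theorem continuous_deltoidP : Continuous deltoidP := by
  unfold deltoidP
  fun_prop

/-- The real part of `z ^ 3` is at most `‖z‖ ^ 3`. -/
theorem re_cube_le (x y : ℝ) :
    x ^ 3 - 3 * x * y ^ 2 ≤ √(x ^ 2 + y ^ 2) ^ 3 := by
  have h : √(x ^ 2 + y ^ 2) ^ 2 = x ^ 2 + y ^ 2 := Real.sq_sqrt (by positivity)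
  apply le_of_sq_le_sq _ (by positivity)
  have e : (√(x ^ 2 + y ^ 2) ^ 3) ^ 2 = (x ^ 2 + y ^ 2) ^ 3 := by
    rw [← pow_mul, mul_comm, pow_mul, h]
  rw [e]
  nlinarith [sq_nonneg (3 * x ^ 2 * y - y ^ 3)]

/-- With `z = x + iy` and `r = ‖z‖`, `deltoidP` is `r⁴ + 18r² - 8 Re z³ - 27`; replacing `Re z³` by
`r³` gives a quartic that factors. -/
theorem deltoidP_radial_lower_bound (x y : ℝ) :
    (√(x ^ 2 + y ^ 2) - 3) ^ 3 * (√(x ^ 2 + y ^ 2) + 1) ≤ deltoidP (x, y) := by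
  have h : √(x ^ 2 + y ^ 2) ^ 2 = x ^ 2 + y ^ 2 := Real.sq_sqrt (by positivity)
  have h3 := re_cube_le x y
  set r := √(x ^ 2 + y ^ 2)
  simp only [deltoidP]
  rw [← h]
  linarith

theorem deltoidP_lower_bound (p : ℝ × ℝ) : -27 ≤ deltoidP p := by
  obtain ⟨x, y⟩ := p
  refine le_trans ?_ (deltoidP_radial_lower_bound x y)
  set r := √(x ^ 2 + y ^ 2)
  nlinarith [sq_nonneg (r * (r - 4)), sq_nonneg r]

theorem sqrt_lt_three_of_deltoidP_neg {x y : ℝ} (h : deltoidP (x, y) < 0) :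
    √(x ^ 2 + y ^ 2) < 3 := by
  by_contra! hr
  have := deltoidP_radial_lower_bound x y
  have : 0 ≤ (√(x ^ 2 + y ^ 2) - 3) ^ 3 * (√(x ^ 2 + y ^ 2) + 1) := by
    have : 0 ≤ √(x ^ 2 + y ^ 2) - 3 := by linarith
    positivity
  linarith

theorem abs_lt_three_of_deltoidP_neg {p : ℝ × ℝ} (h : deltoidP p < 0) :
    |p.1| < 3 ∧ |p.2| < 3 := by
  obtain ⟨x, y⟩ := p
  have h3 := sqrt_lt_three_of_deltoidP_neg h
  exact ⟨(Real.abs_le_sqrt (by nlinarith)).trans_lt h3,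
    (Real.abs_le_sqrt (by nlinarith)).trans_lt h3⟩

theorem isBounded_deltoidP_neg : Bornology.IsBounded {p | deltoidP p < 0} := by
  refine (Metric.isBounded_ball (x := (0 : ℝ × ℝ)) (r := 3)).subset fun p hp => ?_
  obtain ⟨h1, h2⟩ := abs_lt_three_of_deltoidP_neg hp
  simp only [mem_ball_zero_iff, Prod.norm_def, Real.norm_eq_abs]
  exact max_lt h1 h2

/-- `deltoidP` is nondecreasing along rays issuing from the origin. -/
theorem deltoidP_le_smul (p : ℝ × ℝ) {t : ℝ} (ht : 1 ≤ t) : deltoidP p ≤ deltoidP (t • p) := by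
  obtain ⟨x, y⟩ := p
  have h : √(x ^ 2 + y ^ 2) ^ 2 = x ^ 2 + y ^ 2 := Real.sq_sqrt (by positivity)
  have h3 := re_cube_le x y
  set r := √(x ^ 2 + y ^ 2)
  -- The increment along the ray, with `Re z³` replaced by `r³`, is `r²(t - 1)` times this quadratic
  -- in `r`; `hd` says its discriminant is nonpositive.
  have key : 0 ≤ r ^ 2 * ((t + 1) * (t ^ 2 + 1)) - 8 * r * (t ^ 2 + t + 1) + 18 * (t + 1) := by
    have hA : 0 < (t + 1) * (t ^ 2 + 1) := by positivity
    have hd : 16 * (t ^ 2 + t + 1) ^ 2 ≤ 18 * (t + 1) * ((t + 1) * (t ^ 2 + 1)) := by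
      nlinarith [mul_nonneg (show (0 : ℝ) ≤ t ^ 2 + 4 * t + 1 by positivity)
        (sq_nonneg (t - 1))]
    refine nonneg_of_mul_nonneg_right ?_ hA
    nlinarith [sq_nonneg (r * ((t + 1) * (t ^ 2 + 1)) - 4 * (t ^ 2 + t + 1))]
  have h4 : 0 ≤ (t ^ 3 - 1) * (r ^ 3 - (x ^ 3 - 3 * x * y ^ 2)) :=
    mul_nonneg (by have := one_le_pow₀ ht (n := 3); linarith) (by linarith)
  have h5 : 0 ≤ r ^ 2 * (t - 1) * (r ^ 2 * ((t + 1) * (t ^ 2 + 1)) - 8 * r * (t ^ 2 + t + 1)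
      + 18 * (t + 1)) := mul_nonneg (mul_nonneg (sq_nonneg r) (by linarith)) key
  have e : deltoidP (t • (x, y)) - deltoidP (x, y) =
      (t ^ 4 - 1) * (x ^ 2 + y ^ 2) ^ 2 + 18 * (t ^ 2 - 1) * (x ^ 2 + y ^ 2)
        - 8 * (t ^ 3 - 1) * (x ^ 3 - 3 * x * y ^ 2) := by
    simp only [deltoidP, Prod.smul_mk, smul_eq_mul]
    ring
  rw [← h] at e
  nlinarith

/-- Where `deltoidP > 0`, the outward ray stays off the curve, so the component is unbounded. Where
`deltoidP < 0`, the component cannot change sign and stays in a bounded set. -/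
theorem deltoidInterior_eq : deltoidInterior = {p | deltoidP p < 0} := by
  ext p
  constructor
  · rintro ⟨hp, hb⟩
    have hp : deltoidP p ≠ 0 := hp
    by_contra hneg
    have hpos : 0 < deltoidP p := lt_of_le_of_ne (not_lt.1 hneg) hp.symm
    have hp0 : p ≠ 0 := by
      rintro rfl
      norm_num [deltoidP] at hpos
    have hsub : (fun t : ℝ => t • p) '' Ici 1 ⊆ connectedComponentIn deltoidCurveᶜ p := by
      refine IsPreconnected.subset_connectedComponentIn ?_ ⟨1, by simp, by simp⟩ ?_
      · exact isPreconnected_Ici.image _ (by fun_prop)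
      · rintro _ ⟨t, ht, rfl⟩
        exact (hpos.trans_le (deltoidP_le_smul p ht)).ne'
    obtain ⟨C, hC⟩ := (hb.subset hsub).exists_norm_le
    have hn : 0 < ‖p‖ := norm_pos_iff.2 hp0
    have h1 := hC _ ⟨|C| / ‖p‖ + 1, by simpa using by positivity, rfl⟩
    rw [norm_smul, Real.norm_of_nonneg (by positivity), add_mul, div_mul_cancel₀ _ hn.ne'] at h1
    linarith [le_abs_self C]
  · intro hp
    have hp : deltoidP p < 0 := hp
    refine ⟨hp.ne, isBounded_deltoidP_neg.subset fun q hq => ?_⟩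
    by_contra hq0
    have hpm : p ∈ connectedComponentIn deltoidCurveᶜ p := mem_connectedComponentIn hp.ne
    obtain ⟨z, hz, hz0⟩ := isPreconnected_connectedComponentIn.intermediate_value hpm hq
      continuous_deltoidP.continuousOn ⟨hp.le, not_lt.1 hq0⟩
    exact connectedComponentIn_subset _ _ hz hz0

theorem measurableSet_deltoidP_neg : MeasurableSet {p | deltoidP p < 0} :=
  (isOpen_lt continuous_deltoidP continuous_const).measurableSet

theorem measurable_rpow_deltoidP (α : ℝ) : Measurable fun p => (-3 * deltoidP p) ^ α :=
  (measurable_const.mul continuous_deltoidP.measurable).pow_const α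

theorem integrableOn_rpow_deltoidP_mono {α β : ℝ} (hαβ : α ≤ β)
    (h : IntegrableOn (fun p => (-3 * deltoidP p) ^ α) {p | deltoidP p < 0}) :
    IntegrableOn (fun p => (-3 * deltoidP p) ^ β) {p | deltoidP p < 0} := by
  refine Integrable.mono' (h.const_mul (81 ^ (β - α)))
    (measurable_rpow_deltoidP β).aestronglyMeasurable ?_
  refine (ae_restrict_iff' measurableSet_deltoidP_neg).2 (ae_of_all _ fun p hp => ?_)
  have hp : deltoidP p < 0 := hp
  have hd : 0 < -3 * deltoidP p := by linarith
  rw [Real.norm_of_nonneg (by positivity)]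
  calc (-3 * deltoidP p) ^ β = (-3 * deltoidP p) ^ (β - α) * (-3 * deltoidP p) ^ α := by
        rw [← Real.rpow_add hd]; ring_nf
    _ ≤ 81 ^ (β - α) * (-3 * deltoidP p) ^ α := by
        have h1 : -3 * deltoidP p ≤ 81 := by linarith [deltoidP_lower_bound p]
        have h2 : 0 ≤ β - α := by linarith
        gcongr

/-! ### Divergence at the critical exponent -/

/-- The part of the deltoid domain that lies well inside its cusp at `(3, 0)`. -/
theorem deltoidP_cusp {x y : ℝ} (hx : x ∈ Ioo (0 : ℝ) 3)
    (hy : y ∈ Ioo 0 ((3 - x) ^ (3 / 2 : ℝ) / 12)) :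
    deltoidP (x, y) < 0 ∧ -3 * deltoidP (x, y) ≤ 12 * (3 - x) ^ 3 := by
  obtain ⟨hx0, hx3⟩ := hx
  have hu : 0 < 3 - x := by linarith
  have hs : y ^ 2 < (3 - x) ^ 3 / 144 := by
    have h1 : y ^ 2 < ((3 - x) ^ (3 / 2 : ℝ) / 12) ^ 2 := by
      have := hy.1
      gcongr
      exact hy.2
    have h2 : ((3 - x) ^ (3 / 2 : ℝ)) ^ 2 = (3 - x) ^ 3 := by
      rw [← Real.rpow_natCast, ← Real.rpow_mul hu.le, ← Real.rpow_natCast]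
      norm_num
    rw [div_pow, h2] at h1
    norm_num at h1
    exact h1
  have hu3 : 0 < (3 - x) ^ 3 := by positivity
  have hu27 : (3 - x) ^ 3 ≤ 27 := by
    have := pow_le_pow_left₀ hu.le (show 3 - x ≤ 3 by linarith) 3
    norm_num at this
    exact this
  -- As a quadratic in `y²`. Since `y² < 1`, its first two terms are at most `109 y²`, below `(3 -
  -- x)³` because `109 < 144`.
  have e : deltoidP (x, y) =
      (y ^ 2) ^ 2 + (2 * x ^ 2 + 24 * x + 18) * y ^ 2 - (3 - x) ^ 3 * (x + 1) := by
    simp only [deltoidP]; ring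
  have hs0 := sq_nonneg y
  have hB : 2 * x ^ 2 + 24 * x + 18 ≤ 108 := by nlinarith
  constructor
  · rw [e]
    have a1 : (2 * x ^ 2 + 24 * x + 18) * y ^ 2 ≤ 108 * y ^ 2 := by gcongr
    have a2 : (y ^ 2) ^ 2 ≤ 1 * y ^ 2 := by rw [sq (y ^ 2)]; gcongr; linarith
    nlinarith [mul_pos hu3 hx0]
  · rw [e]
    have a1 : 0 ≤ (2 * x ^ 2 + 24 * x + 18) * y ^ 2 := by positivity
    have a2 : 0 ≤ (3 - x) ^ 3 * (3 - x) := by positivity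
    nlinarith [sq_nonneg (y ^ 2)]

theorem not_integrableOn_rpow_deltoidP :
    ¬ IntegrableOn (fun p => (-3 * deltoidP p) ^ (-(5 / 6) : ℝ)) {p | deltoidP p < 0} := by
  intro h
  set S : Set (ℝ × ℝ) := regionBetween (fun _ => 0) (fun x => (3 - x) ^ (3 / 2 : ℝ) / 12)
    (Ioo 0 3) with hS
  have hw : Measurable fun x : ℝ => (3 - x) ^ (3 / 2 : ℝ) / 12 :=
    ((measurable_const.sub measurable_id).pow_const _).div_const _
  have hSm : MeasurableSet S := measurableSet_regionBetween measurable_const hw measurableSet_Ioo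
  have hSub : S ⊆ {p | deltoidP p < 0} := fun p hp => (deltoidP_cusp hp.1 hp.2).1
  set G : ℝ × ℝ → ℝ := S.indicator fun p => (12 * (3 - p.1) ^ 3) ^ (-(5 / 6) : ℝ) with hG
  have hgm : Measurable fun p : ℝ × ℝ => (12 * (3 - p.1) ^ 3) ^ (-(5 / 6) : ℝ) :=
    (measurable_const.mul ((measurable_const.sub measurable_fst).pow_const 3)).pow_const _
  have hGint : Integrable G := by
    rw [hG, integrable_indicator_iff hSm]
    refine Integrable.mono' (h.mono_set hSub) hgm.aestronglyMeasurable ?_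
    refine (ae_restrict_iff' hSm).2 (ae_of_all _ fun p hp => ?_)
    obtain ⟨h1, h2⟩ := deltoidP_cusp hp.1 hp.2
    have h3 : 0 < -3 * deltoidP (p.1, p.2) := by linarith
    rw [Real.norm_of_nonneg (Real.rpow_nonneg (h3.le.trans h2) _)]
    exact Real.rpow_le_rpow_of_nonpos h3 h2 (by norm_num)
  have h1 := hGint.integral_prod_left
  have h2 : IntegrableOn (fun x : ℝ => (3 - x)⁻¹) (Ioo 0 3) := by
    -- The slice integral is width times constant value, with exponent `3/2 - 5/2 = -1`; this factor
    -- clears the constants.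
    have := (h1.integrableOn (s := Ioo 0 3)).const_mul ((12 : ℝ) ^ (5 / 6 : ℝ) * 12)
    refine IntegrableOn.congr_fun this (fun x hx => ?_) measurableSet_Ioo
    have hu : 0 < 3 - x := by linarith [hx.2]
    have e : (fun y => G (x, y)) = (Ioo 0 ((3 - x) ^ (3 / 2 : ℝ) / 12)).indicator
        fun _ => (12 * (3 - x) ^ 3) ^ (-(5 / 6) : ℝ) := by
      funext y
      simp only [hG, hS, indicator, regionBetween, mem_ofPred_eq, hx, true_and]
    simp only [e]
    rw [integral_indicator measurableSet_Ioo, setIntegral_const, measureReal_def,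
      Real.volume_Ioo, sub_zero, ENNReal.toReal_ofReal (by positivity), smul_eq_mul,
      Real.mul_rpow (by norm_num) (by positivity), ← Real.rpow_natCast (3 - x) 3,
      ← Real.rpow_mul hu.le, Real.rpow_neg (by norm_num : (0 : ℝ) ≤ 12)]
    have e2 : (3 - x) ^ (3 / 2 : ℝ) * (3 - x) ^ (((3 : ℕ) : ℝ) * -(5 / 6)) = (3 - x)⁻¹ := by
      rw [← Real.rpow_add hu, ← Real.rpow_neg_one]
      norm_num
    have : (12 : ℝ) ^ (5 / 6 : ℝ) ≠ 0 := by positivity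
    rw [← e2]
    field_simp
  have h3 : IntervalIntegrable (fun x : ℝ => (x - 3)⁻¹) volume 0 3 := by
    rw [intervalIntegrable_iff_integrableOn_Ioo_of_le (by norm_num)]
    refine h2.neg.congr_fun (fun x _ => ?_) measurableSet_Ioo
    simp only [Pi.neg_apply]
    rw [← inv_neg, neg_sub]
  rw [intervalIntegrable_sub_inv_iff] at h3
  norm_num at h3

/-! ### Convergence above the critical exponent -/

theorem lintegral_rpow_const_sub {α w : ℝ} (hα : -1 < α) (hw : 0 < w) :
    ∫⁻ y in Ioo (-w) w, ENNReal.ofReal ((w - y) ^ α) =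
      ENNReal.ofReal ((2 * w) ^ (α + 1) / (α + 1)) := by
  have hi : IntervalIntegrable (fun y : ℝ => (w - y) ^ α) volume (-w) w := by
    have := (intervalIntegral.intervalIntegrable_rpow' (a := 2 * w) (b := 0) hα).comp_sub_left w
    have e : w - 2 * w = -w := by ring
    simpa [e] using this
  rw [← ofReal_integral_eq_lintegral_ofReal
    ((intervalIntegrable_iff_integrableOn_Ioo_of_le (by linarith)).1 hi),
    ← integral_Ioc_eq_integral_Ioo, ← intervalIntegral.integral_of_le (by linarith),
    intervalIntegral.integral_comp_sub_left (fun y => y ^ α), integral_rpow (Or.inl hα)]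
  · congr 2
    rw [sub_self, Real.zero_rpow (by linarith)]
    ring_nf
  · refine (ae_restrict_iff' measurableSet_Ioo).2 (ae_of_all _ fun y hy => ?_)
    exact Real.rpow_nonneg (by linarith [hy.2]) _

theorem lintegral_rpow_const_add {α w : ℝ} (hα : -1 < α) (hw : 0 < w) :
    ∫⁻ y in Ioo (-w) w, ENNReal.ofReal ((w + y) ^ α) =
      ENNReal.ofReal ((2 * w) ^ (α + 1) / (α + 1)) := by
  rw [← lintegral_rpow_const_sub hα hw]
  have := (Measure.measurePreserving_neg (volume : Measure ℝ)).setLIntegral_comp_preimage_emb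
    (MeasurableEquiv.neg ℝ).measurableEmbedding (fun y => ENNReal.ofReal ((w - y) ^ α))
    (Ioo (-w) w)
  simpa using this

/-- In `(w - y)(w + y)` one factor is at least `w`, so its power is at most `w ^ α`; the other is
integrated exactly. -/
theorem lintegral_rpow_sq_sub_sq_le {α w : ℝ} (hα : -1 < α) (hα0 : α ≤ 0) (hw : 0 < w) :
    ∫⁻ y in Ioo (-w) w, ENNReal.ofReal ((w ^ 2 - y ^ 2) ^ α) ≤
      ENNReal.ofReal (2 ^ (α + 2) / (α + 1) * (w ^ 2) ^ (α + 1 / 2)) := by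
  have hα1 : 0 < α + 1 := by linarith
  calc ∫⁻ y in Ioo (-w) w, ENNReal.ofReal ((w ^ 2 - y ^ 2) ^ α)
      ≤ ∫⁻ y in Ioo (-w) w, ENNReal.ofReal (w ^ α) *
          (ENNReal.ofReal ((w - y) ^ α) + ENNReal.ofReal ((w + y) ^ α)) := by
        refine setLIntegral_mono' measurableSet_Ioo fun y hy => ?_
        have h1 : 0 < w - y := by linarith [hy.2]
        have h2 : 0 < w + y := by linarith [hy.1]
        rw [← ENNReal.ofReal_add (by positivity) (by positivity),
          ← ENNReal.ofReal_mul (by positivity)]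
        refine ENNReal.ofReal_le_ofReal ?_
        rw [show w ^ 2 - y ^ 2 = (w - y) * (w + y) by ring, Real.mul_rpow h1.le h2.le]
        have p0 : 0 ≤ w ^ α := by positivity
        have p1 : 0 ≤ (w - y) ^ α := by positivity
        have p2 : 0 ≤ (w + y) ^ α := by positivity
        rcases le_total 0 y with hy0 | hy0
        · have := Real.rpow_le_rpow_of_nonpos hw (show w ≤ w + y by linarith) hα0
          nlinarith
        · have := Real.rpow_le_rpow_of_nonpos hw (show w ≤ w - y by linarith) hα0
          nlinarith
    _ = ENNReal.ofReal (w ^ α * ((2 * w) ^ (α + 1) / (α + 1) + (2 * w) ^ (α + 1) / (α + 1))) := by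
        have hm : Measurable fun y : ℝ => ENNReal.ofReal ((w - y) ^ α) :=
          ((measurable_const.sub measurable_id).pow_const _).ennreal_ofReal
        have hm' : Measurable fun y : ℝ => ENNReal.ofReal ((w + y) ^ α) :=
          ((measurable_const.add measurable_id).pow_const _).ennreal_ofReal
        rw [lintegral_const_mul _ (by fun_prop), lintegral_add_left hm,
          lintegral_rpow_const_sub hα hw, lintegral_rpow_const_add hα hw,
          ← ENNReal.ofReal_add (by positivity) (by positivity),
          ← ENNReal.ofReal_mul (by positivity)]
    _ ≤ _ := by
        refine le_of_eq (congrArg _ ?_)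
        have e1 : (w ^ 2) ^ (α + 1 / 2) = w ^ α * w ^ (α + 1) := by
          rw [← Real.rpow_natCast, ← Real.rpow_mul hw.le, ← Real.rpow_add hw]
          congr 1
          push_cast
          ring
        have e2 : (2 : ℝ) ^ (α + 2) = 2 * 2 ^ (α + 1) := by
          rw [show α + 2 = 1 + (α + 1) by ring, Real.rpow_add (by norm_num), Real.rpow_one]
        rw [e1, e2, Real.mul_rpow (by norm_num) hw.le]
        ring

/-- For `0 ≤ x < 3` the slice of the deltoid domain at `x` is an interval `|y| < w`, with `w ^ 2`
comparable to `(3 - x) ^ 3`, and `-deltoidP` dominates `w ^ 2 - y ^ 2` there. -/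
theorem exists_deltoid_slice {x : ℝ} (hx : x ∈ Ico (0 : ℝ) 3) :
    ∃ w : ℝ, 0 < w ∧ (3 - x) ^ 3 / 108 ≤ w ^ 2 ∧ w ^ 2 ≤ (3 - x) ^ 3 ∧
      ∀ y, deltoidP (x, y) < 0 → y ∈ Ioo (-w) w ∧ w ^ 2 - y ^ 2 ≤ -3 * deltoidP (x, y) := by
  obtain ⟨hx0, hx3⟩ := hx
  -- As a quadratic in `y²`, `deltoidP` has quarter-discriminant `4(2x + 3)³`, so its roots are
  -- polynomial in `m`.
  set m := √(2 * x + 3)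
  have hm : m ^ 2 = 2 * x + 3 := Real.sq_sqrt (by linarith)
  have hm0 : 0 ≤ m := Real.sqrt_nonneg _
  have hm1 : 3 / 2 < m := by nlinarith
  have hm3 : m < 3 := by nlinarith
  have hxm : x = (m ^ 2 - 3) / 2 := by linarith
  have hu : 0 < 3 - m := by linarith
  have ha : 0 < (3 - m) ^ 3 * (m + 1) / 4 := by positivity
  have ew : √((3 - m) ^ 3 * (m + 1) / 4) ^ 2 = (3 - m) ^ 3 * (m + 1) / 4 := Real.sq_sqrt ha.le
  have ex : (3 - x) ^ 3 = (3 - m) ^ 3 * (3 + m) ^ 3 / 8 := by rw [hxm]; ring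
  have hu3 : 0 < (3 - m) ^ 3 := by positivity
  refine ⟨√((3 - m) ^ 3 * (m + 1) / 4), Real.sqrt_pos.2 ha, ?_, ?_, fun y hy => ?_⟩
  · rw [ew, ex]
    have : (3 + m) ^ 3 ≤ 216 * (m + 1) := by
      have := pow_le_pow_left₀ (by linarith) (show 3 + m ≤ 6 by linarith) 3
      linarith
    nlinarith
  · rw [ew, ex]
    have : 2 * (m + 1) ≤ (3 + m) ^ 3 := by nlinarith [pow_pos (show 0 < m by linarith) 3]
    nlinarith
  · have e : -deltoidP (x, y) = ((3 - m) ^ 3 * (m + 1) / 4 - y ^ 2) *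
        (y ^ 2 + (m + 3) ^ 3 * (m - 1) / 4) := by
      rw [hxm]; simp only [deltoidP]; ring
    have hb : 1 ≤ y ^ 2 + (m + 3) ^ 3 * (m - 1) / 4 := by
      have h1 := pow_le_pow_left₀ (by norm_num) (show 3 ≤ m + 3 by linarith) 3
      nlinarith [sq_nonneg y]
    have hpos : 0 < (3 - m) ^ 3 * (m + 1) / 4 - y ^ 2 := by
      refine pos_of_mul_pos_left ?_ (by linarith : 0 ≤ y ^ 2 + (m + 3) ^ 3 * (m - 1) / 4)
      rw [← e]; linarith
    refine ⟨abs_lt.1 (Real.lt_sqrt_of_sq_lt ?_), ?_⟩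
    · rw [sq_abs]; linarith
    · rw [ew]; nlinarith

/-- The sum of constants covers both signs of `β`; the exponent `α + 1/2` to which it is applied
changes sign. -/
theorem rpow_le_add_mul_rpow {a u c C β : ℝ} (hu : 0 < u) (hc : 0 < c) (hC : 0 < C)
    (h1 : c * u ≤ a) (h2 : a ≤ C * u) : a ^ β ≤ (c ^ β + C ^ β) * u ^ β := by
  have hcu : 0 < c * u := by positivity
  have p1 : 0 ≤ c ^ β * u ^ β := by positivity
  have p2 : 0 ≤ C ^ β * u ^ β := by positivity
  rw [add_mul]
  rcases le_total 0 β with hβ | hβ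
  · have := Real.rpow_le_rpow (hcu.le.trans h1) h2 hβ
    rw [Real.mul_rpow hC.le hu.le] at this
    linarith
  · have := Real.rpow_le_rpow_of_nonpos hcu h1 hβ
    rw [Real.mul_rpow hc.le hu.le] at this
    linarith

theorem lintegral_half_deltoid_lt_top {α : ℝ} (hα : -(5 / 6) < α) (hα0 : α ≤ 0) :
    ∫⁻ p in {p | deltoidP p < 0} ∩ {p | 0 ≤ p.1}, ENNReal.ofReal ((-3 * deltoidP p) ^ α) < ⊤ := by
  set S : Set (ℝ × ℝ) := {p | deltoidP p < 0} ∩ {p | 0 ≤ p.1} with hS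
  have hSm : MeasurableSet S :=
    measurableSet_deltoidP_neg.inter (measurableSet_le measurable_const measurable_fst)
  set β := α + 1 / 2 with hβ
  set K := 2 ^ (α + 2) / (α + 1) * ((1 / 108 : ℝ) ^ β + 1 ^ β) with hK
  have hα1 : 0 < α + 1 := by linarith
  have hint : IntegrableOn (fun x : ℝ => K * (3 - x) ^ (3 * β)) (Ico 0 3) := by
    refine Integrable.const_mul ?_ K
    have := (intervalIntegral.intervalIntegrable_rpow' (a := 3) (b := 0)
      -- This is exactly the condition `α > -5/6`.
      (show -1 < 3 * β by rw [hβ]; linarith)).comp_sub_left 3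
    rw [sub_self, sub_zero, intervalIntegrable_iff_integrableOn_Ico_of_le (by norm_num)] at this
    exact this
  have hm : Measurable (S.indicator fun p => ENNReal.ofReal ((-3 * deltoidP p) ^ α)) :=
    (measurable_rpow_deltoidP α).ennreal_ofReal.indicator hSm
  rw [← lintegral_indicator hSm, Measure.volume_eq_prod, lintegral_prod _ hm.aemeasurable]
  refine lt_of_le_of_lt ?_ hint.lintegral_lt_top
  rw [← lintegral_indicator measurableSet_Ico]
  refine lintegral_mono fun x => ?_
  by_cases hx : x ∈ Ico (0 : ℝ) 3
  · rw [indicator_of_mem hx]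
    obtain ⟨w, hw, hw1, hw2, hy⟩ := exists_deltoid_slice hx
    have hu : 0 < 3 - x := by linarith [hx.2]
    calc ∫⁻ y, S.indicator (fun p => ENNReal.ofReal ((-3 * deltoidP p) ^ α)) (x, y)
        ≤ ∫⁻ y, (Ioo (-w) w).indicator (fun y => ENNReal.ofReal ((w ^ 2 - y ^ 2) ^ α)) y := by
          refine lintegral_mono fun y => ?_
          by_cases hp : (x, y) ∈ S
          · obtain ⟨h1, h2⟩ := hy y hp.1
            rw [indicator_of_mem hp, indicator_of_mem h1]
            refine ENNReal.ofReal_le_ofReal (Real.rpow_le_rpow_of_nonpos ?_ h2 hα0)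
            nlinarith [h1.1, h1.2]
          · rw [indicator_of_notMem hp]
            exact zero_le
      _ ≤ ENNReal.ofReal (2 ^ (α + 2) / (α + 1) * (w ^ 2) ^ β) := by
          rw [lintegral_indicator measurableSet_Ioo]
          exact lintegral_rpow_sq_sub_sq_le (by linarith) hα0 hw
      _ ≤ ENNReal.ofReal (K * (3 - x) ^ (3 * β)) := by
          refine ENNReal.ofReal_le_ofReal ?_
          have := rpow_le_add_mul_rpow (a := w ^ 2) (u := (3 - x) ^ 3) (c := 1 / 108) (C := 1)
            (β := β) (by positivity) (by norm_num) (by norm_num) (by linarith) (by linarith)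
          rw [← Real.rpow_natCast (3 - x) 3, ← Real.rpow_mul hu.le] at this
          rw [hK, mul_assoc]
          gcongr
          exact_mod_cast this
  · have : ∀ y, (x, y) ∉ S := fun y hp =>
      hx ⟨hp.2, (abs_lt.1 (abs_lt_three_of_deltoidP_neg hp.1).1).2⟩
    simp [this]

/-! ### Threefold symmetry -/

/-- Rotation of the plane by `2π / 3`. -/
noncomputable def thirdRotation : (ℝ × ℝ) →ₗ[ℝ] ℝ × ℝ :=
  Matrix.toLin (Module.Basis.finTwoProd ℝ) (Module.Basis.finTwoProd ℝ)
    !![-1 / 2, -(√3 / 2); √3 / 2, -1 / 2]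

theorem thirdRotation_apply (p : ℝ × ℝ) :
    thirdRotation p = (-1 / 2 * p.1 + -(√3 / 2) * p.2, √3 / 2 * p.1 + -1 / 2 * p.2) := by
  rw [thirdRotation, Matrix.toLin_finTwoProd_apply]

theorem det_thirdRotation : LinearMap.det thirdRotation = 1 := by
  rw [thirdRotation, LinearMap.det_toLin, Matrix.det_fin_two_of]
  have : √3 * √3 = 3 := Real.mul_self_sqrt (by norm_num)
  linarith

theorem measurePreserving_thirdRotation : MeasurePreserving thirdRotation volume volume := by
  refine ⟨thirdRotation.continuous_of_finiteDimensional.measurable, ?_⟩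
  rw [Measure.map_linearMap_addHaar_eq_smul_addHaar _ (by rw [det_thirdRotation]; norm_num),
    det_thirdRotation]
  simp

theorem deltoidP_thirdRotation (p : ℝ × ℝ) : deltoidP (thirdRotation p) = deltoidP p := by
  obtain ⟨x, y⟩ := p
  rw [thirdRotation_apply]
  have h2 : √3 ^ 2 = 3 := Real.sq_sqrt (by norm_num)
  have h3 : √3 ^ 3 = 3 * √3 := by rw [pow_succ, h2]
  have h4 : √3 ^ 4 = 9 := by rw [show √3 ^ 4 = (√3 ^ 2) ^ 2 by ring, h2]; norm_num
  simp only [deltoidP]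
  ring_nf
  rw [h2, h3, h4]
  ring

/-- The three points sum to zero, so their first coordinates cannot all be negative. -/
theorem exists_nonneg_fst_thirdRotation (p : ℝ × ℝ) :
    0 ≤ p.1 ∨ 0 ≤ (thirdRotation p).1 ∨ 0 ≤ (thirdRotation (thirdRotation p)).1 := by
  by_contra! h
  obtain ⟨h1, h2, h3⟩ := h
  simp only [thirdRotation_apply] at h2 h3
  have : √3 * √3 = 3 := Real.mul_self_sqrt (by norm_num)
  nlinarith

theorem integrableOn_rpow_deltoidP {α : ℝ} (hα : -(5 / 6) < α) (hα0 : α ≤ 0) :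
    IntegrableOn (fun p => (-3 * deltoidP p) ^ α) {p | deltoidP p < 0} := by
  have hR := measurePreserving_thirdRotation
  have hfm := (measurable_rpow_deltoidP α).ennreal_ofReal
  set f : ℝ × ℝ → ENNReal := fun p => ENNReal.ofReal ((-3 * deltoidP p) ^ α) with hf
  set S : Set (ℝ × ℝ) := {p | deltoidP p < 0} ∩ {p | 0 ≤ p.1} with hS
  have hSm : MeasurableSet S :=
    measurableSet_deltoidP_neg.inter (measurableSet_le measurable_const measurable_fst)
  have hfR : ∀ p, f (thirdRotation p) = f p := fun p => by simp only [hf, deltoidP_thirdRotation]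
  have hrot : ∀ T : Set (ℝ × ℝ), MeasurableSet T →
      ∫⁻ p in thirdRotation ⁻¹' T, f p = ∫⁻ p in T, f p := fun T hT => by
    rw [← hR.setLIntegral_comp_preimage hT hfm]
    simp only [hfR]
  have hfin : ∫⁻ p in S, f p < ⊤ := lintegral_half_deltoid_lt_top hα hα0
  have hcover : {p | deltoidP p < 0} ⊆
      S ∪ (thirdRotation ⁻¹' S ∪ thirdRotation ⁻¹' (thirdRotation ⁻¹' S)) := fun p hp => by
    have hp : deltoidP p < 0 := hp
    simp only [hS, mem_union, mem_preimage, mem_inter_iff, mem_ofPred_eq, deltoidP_thirdRotation,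
      hp, true_and]
    exact exists_nonneg_fst_thirdRotation p
  refine ⟨(measurable_rpow_deltoidP α).aestronglyMeasurable, ?_⟩
  have hnn : 0 ≤ᵐ[volume.restrict {p | deltoidP p < 0}] fun p => (-3 * deltoidP p) ^ α := by
    refine (ae_restrict_iff' measurableSet_deltoidP_neg).2 (ae_of_all _ fun p hp => ?_)
    have hp : deltoidP p < 0 := hp
    exact Real.rpow_nonneg (by linarith) _
  rw [hasFiniteIntegral_iff_ofReal hnn]
  refine (lintegral_mono_set hcover).trans_lt ((lintegral_union_le _ _ _).trans_lt ?_)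
  refine ENNReal.add_lt_top.2 ⟨hfin, (lintegral_union_le _ _ _).trans_lt ?_⟩
  rw [hrot _ (hR.measurable hSm), hrot _ hSm]
  exact ENNReal.add_lt_top.2 ⟨hfin, hfin⟩

theorem mainTheorem3 :
    (∀ x : ℝ × ℝ, (deltoidG x).det = -3 * deltoidP x) ∧
    (∀ x ∈ deltoidInterior, 0 < (deltoidG x).det) ∧
    (∀ α : ℝ,
      MeasureTheory.IntegrableOn (fun x : ℝ × ℝ => (deltoidG x).det ^ α) deltoidInterior
        MeasureTheory.volume ↔ -(5 / 6 : ℝ) < α) := by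
  refine ⟨deltoidG_det, fun x hx => ?_, fun α => ?_⟩
  · rw [deltoidInterior_eq] at hx
    have hx : deltoidP x < 0 := hx
    rw [deltoidG_det]
    linarith
  · simp only [deltoidG_det, deltoidInterior_eq]
    constructor
    · intro h
      by_contra! hα
      exact not_integrableOn_rpow_deltoidP (integrableOn_rpow_deltoidP_mono hα h)
    · intro hα
      -- Convergence is known only for nonpositive exponents; positive `α` is compared with `0`.
      exact integrableOn_rpow_deltoidP_mono (min_le_left α 0)
        (integrableOn_rpow_deltoidP (lt_min hα (by norm_num)) (min_le_right α 0))
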